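/- Let $\mu(dx)=\frac{1}{2\pi}\sqrt{4-x^2}\,dx$ be the standard semicircle law on $[-2,2]$, and let $(\Phi_n)_{n\ge 0}$ be its monic orthogonal polynomials, i.e. $\Phi_0=1$, $\Phi_1=x$, $x\Phi_{n+1}=\Phi_{n+2}+\Phi_n$ (equivalently $\Phi_n(2\cos\theta)\sin\theta=\sin((n+1)\theta)$); they form an orthonormal basis of the complex Hilbert space $L^2([-2,2],\mu)$. Let $a^+$ and $a$ be the bounded operators on $L^2([-2,2],\mu)$ with $a^+\Phi_n=\Phi_{n+1}$, $a\Phi_{n+1}=\Phi_n$ $(n\ge 0)$ and $a\Phi_0=0$, and let $P_X=i(a^+-a)$ be the canonical momentum operator. For a function $f$ define its $\mu$-Hilbert transform by $$H_\mu f(x)=2\,\mathrm{p.v.}\!\int_{-2}^{2}\frac{f(y)}{x-y}\,\mu(dy):=2\lim_{\varepsilon\downarrow 0}\int_{\{|x-y|>\varepsilon\}}\frac{f(y)}{x-y}\,\mu(dy)$$ at every $x$ at which this limit exists. Then for every $f\in L^2([-2,2],\mu)$ the principal value $H_\mu f(x)$ exists for $\mu$-almost every $x$, $H_\mu f\in L^2([-2,2],\mu)$,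 and $$P_Xf(x)=i\,H_\mu f(x)=2i\,\mathrm{p.v.}\!\int_{-2}^{2}\frac{f(y)}{x-y}\,\mu(dy)\qquad\text{for }\mu\text{-a.e. }x,$$ that is, $P_X=iH_\mu$ on $L^2([-2,2],\mu)$. In particular, the free kinetic energy operator $E_X:=\frac12P_X^2$ is given by $E_X=-\frac12H_\mu^2$. -/

import Mathlib

open MeasureTheory Filter Topology Polynomial

namespace FreeQM

noncomputable section

/-- The standard semicircle law `μ(dx) = √(4 - x²) / (2π) dx` on `[-2, 2]`
(`Real.sqrt` vanishes on negative numbers, so the density is `0` outside `[-2, 2]`). -/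
def semicircleLaw : Measure ℝ :=
  volume.withDensity fun x => ENNReal.ofReal (√(4 - x ^ 2) / (2 * Real.pi))

/-- The complex Hilbert space `L²([-2, 2], μ)`. -/
abbrev L2mu : Type := Lp ℂ 2 semicircleLaw

/-! ### The orthogonal polynomials of the semicircle law -/

/-- The polynomial functions `Φ_n`, `n ≥ 0`, determined by `Φ_0 = 1`, `Φ_1 = x` and
`x Φ_{n+1} = Φ_{n+2} + Φ_n`. -/
def Phi (n : ℕ) (x : ℝ) : ℝ := (Chebyshev.S ℝ n).eval x

theorem Phi_zero (x : ℝ) : Phi 0 x = 1 := by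
  simp [Phi]

theorem Phi_one (x : ℝ) : Phi 1 x = x := by
  simp [Phi]

theorem Phi_recurrence (n : ℕ) (x : ℝ) : x * Phi (n + 1) x = Phi (n + 2) x + Phi n x := by
  have h := congrArg (Polynomial.eval x) (Chebyshev.S_add_two ℝ (n : ℤ))
  simp only [eval_sub, eval_mul, eval_X] at h
  simp only [Phi]
  push_cast
  linarith

/-- `Φ_n(2 cos θ) sin θ = sin ((n + 1) θ)`. -/
theorem Phi_two_mul_cos (n : ℕ) (θ : ℝ) :
    Phi n (2 * Real.cos θ) * Real.sin θ = Real.sin ((n + 1) * θ) := by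
  simp [Phi]

theorem continuous_Phi (n : ℕ) : Continuous (Phi n) :=
  (Chebyshev.S ℝ n).continuous

theorem density_eq_zero {x : ℝ} (hx : x ∉ Set.Icc (-2 : ℝ) 2) : √(4 - x ^ 2) = 0 := by
  apply Real.sqrt_eq_zero_of_nonpos
  by_contra h
  exact hx (abs_le.1 (abs_le_of_sq_le_sq (by linarith) (by norm_num)))

theorem integrable_semicircleLaw {f : ℝ → ℝ} (hf : Continuous f) :
    Integrable f semicircleLaw := by
  rw [semicircleLaw, integrable_withDensity_iff (by fun_prop) (by simp)]
  rw [← integrableOn_iff_integrable_of_support_subset (s := Set.Icc (-2 : ℝ) 2)]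
  · refine ContinuousOn.integrableOn_compact isCompact_Icc (Continuous.continuousOn ?_)
    simp only [ENNReal.toReal_ofReal (show 0 ≤ √(4 - (_ : ℝ) ^ 2) / (2 * Real.pi) by positivity)]
    fun_prop
  · intro x hx
    by_contra h
    exact hx (by simp [density_eq_zero h])

theorem memLp_Phi (n : ℕ) : MemLp (fun x => (Phi n x : ℂ)) 2 semicircleLaw := by
  have hc : Continuous fun x => (Phi n x : ℂ) :=
    Complex.continuous_ofReal.comp (continuous_Phi n)
  rw [memLp_two_iff_integrable_sq_norm hc.aestronglyMeasurable]
  exact integrable_semicircleLaw (by fun_prop)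

/-- `Φ_n` as a vector of `L²(μ)`. -/
def phi (n : ℕ) : L2mu := (memLp_Phi n).toLp _

theorem integral_semicircleLaw (f : ℝ → ℝ) :
    ∫ x, f x ∂semicircleLaw =
      (2 / Real.pi) * ∫ θ in (0 : ℝ)..Real.pi, f (2 * Real.cos θ) * Real.sin θ ^ 2 := by
  have h1 : ∫ x, f x ∂semicircleLaw =
      ∫ x in (-2 : ℝ)..2, √(4 - x ^ 2) / (2 * Real.pi) * f x := by
    rw [semicircleLaw, integral_withDensity_eq_integral_toReal_smul (by fun_prop) (by simp),
      intervalIntegral.integral_of_le (by norm_num), ← integral_Icc_eq_integral_Ioc,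
      setIntegral_eq_integral_of_forall_compl_eq_zero]
    · refine integral_congr_ae (Eventually.of_forall fun x => ?_)
      simp only [smul_eq_mul]
      rw [ENNReal.toReal_ofReal (by positivity)]
    · intro x hx
      simp [density_eq_zero hx]
  have h2 : ∫ θ in (0 : ℝ)..Real.pi, f (2 * Real.cos θ) * Real.sin θ ^ 2 =
      ∫ x in (-1 : ℝ)..1, (f (2 * x) * (1 - x ^ 2)) * √(1 - x ^ 2)⁻¹ := by
    rw [← Chebyshev.integral_measureT, Chebyshev.integral_measureT_eq_integral_cos]
    simp only [Real.sin_sq]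
  have h3 := intervalIntegral.smul_integral_comp_mul_left
    (a := -1) (b := 1) (fun x => √(4 - x ^ 2) / (2 * Real.pi) * f x) (2 : ℝ)
  norm_num at h3
  rw [h1, h2, ← h3, ← intervalIntegral.integral_const_mul, ← intervalIntegral.integral_const_mul]
  refine intervalIntegral.integral_congr fun x hx => ?_
  rw [Set.uIcc_of_le (by norm_num)] at hx
  have hx0 : 0 ≤ 1 - x ^ 2 := by nlinarith [hx.1, hx.2]
  have e1 : √(4 - (2 * x) ^ 2) = 2 * √(1 - x ^ 2) := by
    rw [show 4 - (2 * x) ^ 2 = 2 ^ 2 * (1 - x ^ 2) by ring, Real.sqrt_mul (by positivity),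
      Real.sqrt_sq (by norm_num)]
  have e2 : (1 - x ^ 2) * √(1 - x ^ 2)⁻¹ = √(1 - x ^ 2) := by
    rw [Real.sqrt_inv, ← div_eq_mul_inv, Real.div_sqrt]
  rw [e1, mul_assoc (f (2 * x)), e2]
  field_simp

theorem integral_sin_mul_sin (m n : ℕ) :
    ∫ θ in (0 : ℝ)..Real.pi, Real.sin ((m + 1) * θ) * Real.sin ((n + 1) * θ) =
      if m = n then Real.pi / 2 else 0 := by
  have hcos : ∀ k : ℤ, ∫ θ in (0 : ℝ)..Real.pi, Real.cos (k * θ) =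
      if k = 0 then Real.pi else 0 := by
    intro k
    split_ifs with hk
    · simp [hk]
    · have hk' : (k : ℝ) ≠ 0 := by exact_mod_cast hk
      rw [intervalIntegral.integral_comp_mul_left _ hk']
      simp [Real.sin_int_mul_pi]
  have e : ∀ θ : ℝ, Real.sin ((m + 1) * θ) * Real.sin ((n + 1) * θ) =
      (1 / 2) * (Real.cos (((m - n : ℤ) : ℝ) * θ) - Real.cos (((m + n + 2 : ℤ) : ℝ) * θ)) := by
    intro θ
    push_cast
    rw [show ((m : ℝ) - n) * θ = (m + 1) * θ - (n + 1) * θ by ring,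
      show ((m : ℝ) + n + 2) * θ = (m + 1) * θ + (n + 1) * θ by ring,
      Real.cos_sub, Real.cos_add]
    ring
  simp only [e]
  rw [intervalIntegral.integral_const_mul, intervalIntegral.integral_sub
    (Continuous.intervalIntegrable (by fun_prop) _ _)
    (Continuous.intervalIntegrable (by fun_prop) _ _), hcos, hcos,
    if_neg (show ((m : ℤ) + n + 2) ≠ 0 by omega)]
  by_cases h : m = n
  · simp [h]; ring
  · rw [if_neg (by omega), if_neg h]; simp

/-- The `Φ_n` are orthonormal in `L²(μ)`. -/
theorem orthonormal_phi : Orthonormal ℂ phi := by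
  classical
  rw [orthonormal_iff_ite]
  intro m n
  have h1 : inner ℂ (phi m) (phi n) =
      ∫ x, ((Phi m x * Phi n x : ℝ) : ℂ) ∂semicircleLaw := by
    rw [L2.inner_def]
    refine integral_congr_ae ?_
    filter_upwards [(memLp_Phi m).coeFn_toLp, (memLp_Phi n).coeFn_toLp] with x hm hn
    simp only [phi]
    rw [hm, hn]
    simp [mul_comm]
  have h2 : ∀ θ : ℝ, Phi m (2 * Real.cos θ) * Phi n (2 * Real.cos θ) * Real.sin θ ^ 2 =
      Real.sin ((m + 1) * θ) * Real.sin ((n + 1) * θ) := by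
    intro θ
    rw [← Phi_two_mul_cos, ← Phi_two_mul_cos]
    ring
  rw [h1, integral_complex_ofReal, integral_semicircleLaw]
  simp only [h2]
  rw [integral_sin_mul_sin]
  split_ifs
  · field_simp; norm_num
  · simp

/-! ### Creation, annihilation, momentum and kinetic energy operators -/

/-- The isometry `ℓ²(ℕ) → L²(μ)`, `c ↦ ∑ₙ cₙ Φ_n`. -/
def fock : lp (fun _ : ℕ => ℂ) 2 →ₗᵢ[ℂ] L2mu :=
  orthonormal_phi.orthogonalFamily.linearIsometry

/-- The isometry `ℓ²(ℕ) → L²(μ)`, `c ↦ ∑ₙ cₙ Φ_{n+1}`. -/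
def fockSucc : lp (fun _ : ℕ => ℂ) 2 →ₗᵢ[ℂ] L2mu :=
  (orthonormal_phi.comp Nat.succ Nat.succ_injective).orthogonalFamily.linearIsometry

/-- The creation operator `a⁺ f = ∑ₙ ⟨Φ_n, f⟩ Φ_{n+1}`, i.e. `a⁺ Φ_n = Φ_{n+1}`. -/
def creation : L2mu →L[ℂ] L2mu :=
  fockSucc.toContinuousLinearMap ∘L ContinuousLinearMap.adjoint fock.toContinuousLinearMap

/-- The annihilation operator `a f = ∑ₙ ⟨Φ_{n+1}, f⟩ Φ_n`, i.e. `a Φ_0 = 0` and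
`a Φ_{n+1} = Φ_n`. -/
def annihilation : L2mu →L[ℂ] L2mu :=
  fock.toContinuousLinearMap ∘L ContinuousLinearMap.adjoint fockSucc.toContinuousLinearMap

theorem fock_single (n : ℕ) : fock (lp.single 2 n (1 : ℂ)) = phi n := by
  simp [fock]

theorem fockSucc_single (n : ℕ) : fockSucc (lp.single 2 n (1 : ℂ)) = phi (n + 1) := by
  simp [fockSucc]

theorem adjoint_apply_self (V : lp (fun _ : ℕ => ℂ) 2 →ₗᵢ[ℂ] L2mu)
    (c : lp (fun _ : ℕ => ℂ) 2) :
    ContinuousLinearMap.adjoint V.toContinuousLinearMap (V c) = c := by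
  refine ext_inner_right ℂ fun d => ?_
  rw [ContinuousLinearMap.adjoint_inner_left]
  exact V.inner_map_map c d

theorem creation_phi (n : ℕ) : creation (phi n) = phi (n + 1) := by
  rw [← fock_single, creation, ContinuousLinearMap.comp_apply, adjoint_apply_self]
  exact fockSucc_single n

theorem annihilation_phi_succ (n : ℕ) : annihilation (phi (n + 1)) = phi n := by
  rw [← fockSucc_single, annihilation, ContinuousLinearMap.comp_apply, adjoint_apply_self]
  exact fock_single n

theorem annihilation_phi_zero : annihilation (phi 0) = 0 := by
  have h : ContinuousLinearMap.adjoint fockSucc.toContinuousLinearMap (phi 0) = 0 := by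
    ext n
    have h1 := lp.inner_single_left (𝕜 := ℂ) n (1 : ℂ)
      (ContinuousLinearMap.adjoint fockSucc.toContinuousLinearMap (phi 0))
    rw [ContinuousLinearMap.adjoint_inner_right] at h1
    have h2 : inner ℂ (fockSucc.toContinuousLinearMap (lp.single 2 n (1 : ℂ))) (phi 0) = 0 := by
      change inner ℂ (fockSucc (lp.single 2 n (1 : ℂ))) (phi 0) = 0
      rw [fockSucc_single]
      exact orthonormal_phi.2 (Nat.succ_ne_zero n)
    rw [h2] at h1
    simpa using h1.symm
  rw [annihilation, ContinuousLinearMap.comp_apply, h, map_zero]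

/-- The momentum operator `P_X = i (a⁺ - a)`. -/
def momentum : L2mu →L[ℂ] L2mu := Complex.I • (creation - annihilation)

/-- The free kinetic energy operator `E_X = P_X² / 2`. -/
def kineticEnergy : L2mu →L[ℂ] L2mu := (1 / 2 : ℂ) • (momentum ∘L momentum)

/-! ### The Hilbert transform with respect to the semicircle law -/

/-- `2 p.v. ∫ f(y) / (x - y) μ(dy)` exists and equals `L`. -/
def HasMuHilbertAt (f : ℝ → ℂ) (x : ℝ) (L : ℂ) : Prop :=
  (∀ ε : ℝ, 0 < ε →
    IntegrableOn (fun y : ℝ => f y / ((x : ℂ) - (y : ℂ))) {y | ε < |x - y|} semicircleLaw) ∧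
  Tendsto
    (fun ε : ℝ => 2 * ∫ y in {y : ℝ | ε < |x - y|}, f y / ((x : ℂ) - (y : ℂ)) ∂semicircleLaw)
    (𝓝[>] 0) (𝓝 L)

open Classical in
/-- The `μ`-Hilbert transform `H_μ f(x) = 2 p.v. ∫ f(y) / (x - y) μ(dy)`; by convention it is `0`
at the points `x` where the principal value does not exist. -/
def muHilbert (f : ℝ → ℂ) (x : ℝ) : ℂ :=
  if h : ∃ L, HasMuHilbertAt f x L then h.choose else 0

end

end FreeQM

/-! Write `D = a⁺ - a`, so that `P_X = i D`; the claim is that `D f` is the boundary value of a sum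
of Cauchy transforms. For nonreal `z = m + 1/m` with `|m| < 1`, the generating function of the `Φ_n`
gives `1/(z - y) = ∑ m^(n+1) Φ_n(y)` in `L²(μ)`. On this vector `a` acts as multiplication by `m`,
and `a⁺` as multiplication by `1/m` followed by subtraction of `Φ_0`. Taking adjoints, the Cauchy
transforms `G` satisfy `(1/m - m) G_f(z) = ∫ f dμ - G_{Df}(z)` (`cauchyTransform_ladderDiff`).

Put `z = x ± iε` with `|x| < 2`. Then `1/m - m` tends to `± i √(4 - x²)`, so in the sum `G_f(x + iε)
+ G_f(x - iε)` the constant `∫ f dμ` drops out and only the jump of `G_{Df}` across the axis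
survives. By the Poisson kernel this jump is `-2πi` times the density times `D f(x)`, and the sum
tends to `D f(x)` (`tendsto_cauchyTransform_add`). The same sum differs from twice the truncated
integral by convolution with an odd kernel of Poisson size, which vanishes in the limit at Lebesgue
points (`tendsto_cauchyTransform_add_sub_truncated`). Hence the principal value exists almost
everywhere and equals `D f`; no separate `L²` or maximal bound for the Hilbert transform is needed.
-/

/-! ### Approximation by Poisson-type kernels at Lebesgue points -/

/-- `x` is a Lebesgue point of `g`. -/
def IsLebesguePoint (g : ℝ → ℂ) (x : ℝ) : Prop :=
  Tendsto (fun r : ℝ => (∫ y in Metric.closedBall x r, ‖g y - g x‖) / r) (𝓝[>] 0) (𝓝 0)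

theorem ae_isLebesguePoint {g : ℝ → ℂ} (hg : Integrable g) :
    ∀ᵐ x, IsLebesguePoint g x := by
  filter_upwards [(Besicovitch.vitaliFamily (volume : Measure ℝ)).ae_tendsto_average_norm_sub
    hg.locallyIntegrable] with x hx
  -- The average divides by the length `2r` of the ball, `IsLebesguePoint` only by `r`.
  have h := (hx.comp (Besicovitch.tendsto_filterAt volume x)).const_mul 2
  rw [mul_zero] at h
  refine h.congr' ?_
  filter_upwards [self_mem_nhdsWithin] with r (hr : 0 < r)
  simp only [Function.comp, setAverage_eq, smul_eq_mul, measureReal_def, Real.volume_closedBall]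
  rw [ENNReal.toReal_ofReal (by positivity)]
  field_simp

theorem integrableOn_norm_sub {g : ℝ → ℂ} (hg : Integrable g) (c : ℂ) (x r : ℝ) :
    IntegrableOn (fun y => ‖g y - c‖) (Metric.closedBall x r) :=
  (hg.integrableOn.sub (integrableOn_const Metric.isBounded_closedBall.measure_lt_top.ne)).norm

/-- Small radii are controlled by the limit, large ones by the `L¹` norm of `g`. Uniformity over all
`r` is what dominates the dyadic series below. -/
theorem IsLebesguePoint.exists_bound {g : ℝ → ℂ} {x : ℝ} (hx : IsLebesguePoint g x)
    (hg : Integrable g) :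
    ∃ M, ∀ r, 0 < r → (∫ y in Metric.closedBall x r, ‖g y - g x‖) / r ≤ M := by
  have h1 := hx.eventually (gt_mem_nhds (zero_lt_one' ℝ))
  rw [eventually_nhdsWithin_iff, Metric.eventually_nhds_iff] at h1
  obtain ⟨r₀, hr₀, h1⟩ := h1
  refine ⟨max 1 ((∫ y, ‖g y‖) / r₀ + 2 * ‖g x‖), fun r hr => ?_⟩
  rcases lt_or_ge r r₀ with h | h
  · exact le_max_of_le_left (h1 (by simpa [abs_of_pos hr] using h) hr).le
  · refine le_max_of_le_right ?_
    have h2 : ∫ y in Metric.closedBall x r, ‖g y - g x‖ ≤ (∫ y, ‖g y‖) + 2 * r * ‖g x‖ := by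
      calc ∫ y in Metric.closedBall x r, ‖g y - g x‖
          ≤ ∫ y in Metric.closedBall x r, (‖g y‖ + ‖g x‖) :=
            integral_mono (integrableOn_norm_sub hg _ _ _)
              (hg.norm.integrableOn.add (integrableOn_const Metric.isBounded_closedBall.measure_lt_top.ne))
              (fun y => norm_sub_le _ _)
        _ = (∫ y in Metric.closedBall x r, ‖g y‖) + 2 * r * ‖g x‖ := by
            rw [integral_add hg.norm.integrableOn
              (integrableOn_const Metric.isBounded_closedBall.measure_lt_top.ne)]
            simp [measureReal_def, Real.volume_closedBall, hr.le]
        _ ≤ _ := by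
            gcongr 1
            exact setIntegral_le_integral hg.norm (Eventually.of_forall fun y => norm_nonneg _)
    calc _ ≤ ((∫ y, ‖g y‖) + 2 * r * ‖g x‖) / r := by gcongr
      _ = (∫ y, ‖g y‖) / r + 2 * ‖g x‖ := by field_simp
      _ ≤ _ := by
        gcongr

/-- Take the least `j` with `|t| ≤ 2^j ε`: if `j > 0`, minimality gives `|t| > 2^(j-1) ε`, whence
the factor 4. The Poisson kernel is thus dominated by a sum of weighted indicators of balls. -/
theorem exists_dyadic_poisson_le {ε : ℝ} (hε : 0 < ε) (t : ℝ) :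
    ∃ j : ℕ, |t| ≤ 2 ^ j * ε ∧ ε / (t ^ 2 + ε ^ 2) ≤ 4 / (4 ^ j * ε) := by
  have hex : ∃ j : ℕ, |t| ≤ 2 ^ j * ε := by
    obtain ⟨j, hj⟩ := pow_unbounded_of_one_lt (|t| / ε) (one_lt_two)
    exact ⟨j, by rw [div_lt_iff₀ hε] at hj; exact hj.le⟩
  classical
  refine ⟨Nat.find hex, Nat.find_spec hex, ?_⟩
  rcases h : Nat.find hex with _ | i
  · rw [div_le_div_iff₀ (by positivity) (by positivity)]
    nlinarith [sq_nonneg t]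
  · have hi : 2 ^ i * ε < |t| := not_le.1 (Nat.find_min hex (m := i) (by omega))
    have h2 : (2 ^ i * ε) ^ 2 < t ^ 2 := by
      rw [← sq_abs t]
      gcongr
    have h4 : (4 : ℝ) ^ i = 2 ^ i * 2 ^ i := by rw [← mul_pow]; norm_num
    rw [div_le_div_iff₀ (by positivity) (by positivity), pow_succ, h4]
    nlinarith [sq_nonneg ε]

/-- The ball of radius `2^j ε` with weight `4 / (4^j ε)` contributes `4 · 2^(-j) b(2^j ε)`. Each
term tends to 0 and a geometric series dominates, so the sum tends to 0. -/
theorem IsLebesguePoint.tendsto_integral_poisson {g : ℝ → ℂ} {x : ℝ} (hx : IsLebesguePoint g x)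
    (hg : Integrable g) :
    Tendsto (fun ε : ℝ => ∫ y, ‖g y - g x‖ * (ε / ((x - y) ^ 2 + ε ^ 2))) (𝓝[>] 0) (𝓝 0) := by
  set b : ℝ → ℝ := fun r => (∫ y in Metric.closedBall x r, ‖g y - g x‖) / r with hb
  obtain ⟨M, hM⟩ := hx.exists_bound hg
  have hb0 : ∀ r, 0 < r → 0 ≤ b r := fun r hr =>
    div_nonneg (integral_nonneg fun y => norm_nonneg _) hr.le
  have hbound : ∀ ε : ℝ, 0 < ε → ∀ j : ℕ,
      ‖4 * (1 / 2 : ℝ) ^ j * b (2 ^ j * ε)‖ ≤ 4 * (1 / 2 : ℝ) ^ j * M := by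
    intro ε hε j
    have := hb0 (2 ^ j * ε) (by positivity)
    rw [Real.norm_of_nonneg (by positivity)]
    gcongr
    exact hM _ (by positivity)
  have hsum : Summable fun j : ℕ => 4 * (1 / 2 : ℝ) ^ j * M :=
    (summable_geometric_two.mul_left 4).mul_right M
  have hlim : Tendsto (fun ε : ℝ => ∑' j : ℕ, 4 * (1 / 2 : ℝ) ^ j * b (2 ^ j * ε))
      (𝓝[>] 0) (𝓝 0) := by
    have h0 : (0 : ℝ) = ∑' _ : ℕ, (0 : ℝ) := tsum_zero.symm
    refine Eq.subst (motive := fun L => Tendsto _ _ (𝓝 L)) h0.symm ?_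
    refine tendsto_tsum_of_dominated_convergence hsum (fun j => ?_) ?_
    · have h1 : Tendsto (fun ε : ℝ => b (2 ^ j * ε)) (𝓝[>] 0) (𝓝 0) := by
        refine Tendsto.comp hx ?_
        refine tendsto_nhdsWithin_iff.2 ⟨?_, ?_⟩
        · refine tendsto_nhdsWithin_of_tendsto_nhds ?_
          exact Continuous.tendsto' (by fun_prop) _ _ (by simp)
        · filter_upwards [self_mem_nhdsWithin] with ε (hε : 0 < ε)
          exact Set.mem_Ioi.2 (by positivity)
      simpa using h1.const_mul (4 * (1 / 2 : ℝ) ^ j)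
    · filter_upwards [self_mem_nhdsWithin] with ε hε
      exact hbound ε hε
  refine tendsto_of_tendsto_of_tendsto_of_le_of_le' tendsto_const_nhds hlim ?_ ?_
  · filter_upwards [self_mem_nhdsWithin] with ε (hε : 0 < ε)
    exact integral_nonneg fun y => by positivity
  filter_upwards [self_mem_nhdsWithin] with ε (hε : 0 < ε)
  have hgm : AEStronglyMeasurable (fun y => ‖g y - g x‖) volume :=
    (hg.aestronglyMeasurable.sub aestronglyMeasurable_const).norm
  have hS : Summable fun j : ℕ => 4 * (1 / 2 : ℝ) ^ j * b (2 ^ j * ε) :=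
    Summable.of_norm_bounded hsum (hbound ε hε)
  have hnn : ∀ j : ℕ, 0 ≤ 4 * (1 / 2 : ℝ) ^ j * b (2 ^ j * ε) := fun j => by
    have := hb0 (2 ^ j * ε) (by positivity)
    positivity
  have hPm : AEStronglyMeasurable (fun y => ‖g y - g x‖ * (ε / ((x - y) ^ 2 + ε ^ 2))) volume :=
    hgm.mul (Measurable.aestronglyMeasurable (by fun_prop))
  -- With values in `[0, ∞]`, sum and integral can be exchanged without an integrability check.
  rw [integral_eq_lintegral_of_nonneg_ae (Eventually.of_forall fun y => by positivity) hPm]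
  refine ENNReal.toReal_le_of_le_ofReal (tsum_nonneg hnn) ?_
  rw [ENNReal.ofReal_tsum_of_nonneg hnn hS]
  set J : ℕ → ℝ → ℝ := fun j =>
    (Metric.closedBall x (2 ^ j * ε)).indicator fun y => 4 / (4 ^ j * ε) * ‖g y - g x‖ with hJ
  have hJint : ∀ j, Integrable (J j) := fun j =>
    IntegrableOn.integrable_indicator ((integrableOn_norm_sub hg (g x) x _).const_mul _)
      Metric.isClosed_closedBall.measurableSet
  have hJ0 : ∀ j y, 0 ≤ J j y := fun j y => Set.indicator_nonneg (fun y _ => by positivity) _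
  have hJval : ∀ j, ∫⁻ y, ENNReal.ofReal (J j y) =
      ENNReal.ofReal (4 * (1 / 2 : ℝ) ^ j * b (2 ^ j * ε)) := by
    intro j
    rw [← ofReal_integral_eq_lintegral_ofReal (hJint j) (Eventually.of_forall (hJ0 j)), hJ,
      integral_indicator Metric.isClosed_closedBall.measurableSet, integral_const_mul, hb]
    congr 1
    have h4 : (4 : ℝ) ^ j = 2 ^ j * 2 ^ j := by rw [← mul_pow]; norm_num
    simp only [h4, one_div, inv_pow]
    field_simp
  calc ∫⁻ y, ENNReal.ofReal (‖g y - g x‖ * (ε / ((x - y) ^ 2 + ε ^ 2)))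
      ≤ ∫⁻ y, ∑' j, ENNReal.ofReal (J j y) := by
        refine lintegral_mono fun y => ?_
        obtain ⟨j, hj1, hj2⟩ := exists_dyadic_poisson_le hε (x - y)
        refine le_trans (ENNReal.ofReal_le_ofReal ?_) (ENNReal.le_tsum j)
        have : y ∈ Metric.closedBall x (2 ^ j * ε) := by
          rwa [Metric.mem_closedBall, dist_comm, Real.dist_eq]
        simp only [hJ, Set.indicator_of_mem this]
        rw [mul_comm]
        gcongr
    _ = ∑' j, ENNReal.ofReal (4 * (1 / 2 : ℝ) ^ j * b (2 ^ j * ε)) := by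
        rw [lintegral_tsum fun j => (hJint j).aestronglyMeasurable.aemeasurable.ennreal_ofReal]
        simp only [hJval]

theorem integrable_poisson {ε : ℝ} (hε : 0 < ε) :
    Integrable fun t : ℝ => ε / (t ^ 2 + ε ^ 2) := by
  refine ((integrable_inv_one_add_sq.comp_div hε.ne').const_mul ε⁻¹).congr
    (Eventually.of_forall fun t => ?_)
  dsimp only
  field_simp
  ring

theorem integral_poisson {ε : ℝ} (hε : 0 < ε) :
    ∫ t : ℝ, ε / (t ^ 2 + ε ^ 2) = Real.pi := by
  have h := Measure.integral_comp_div (fun t : ℝ => (1 + t ^ 2)⁻¹) ε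
  rw [integral_univ_inv_one_add_sq, abs_of_pos hε, smul_eq_mul] at h
  have h2 : (fun t : ℝ => ε / (t ^ 2 + ε ^ 2)) = fun t => ε⁻¹ * (1 + (t / ε) ^ 2)⁻¹ := by
    ext t
    field_simp
    ring
  rw [h2, integral_const_mul, h]
  field_simp

/-- At a Lebesgue point of `g`, convolution with kernels dominated by multiples of Poisson
kernels converges to the value of `g` times the common integral of the kernels. -/
theorem IsLebesguePoint.tendsto_integral_kernel {g : ℝ → ℂ} {x : ℝ} (hx : IsLebesguePoint g x)
    (hg : Integrable g) {R : ℝ → ℝ → ℂ} {C : ℝ} {c : ℂ}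
    (hm : ∀ ε, 0 < ε → Measurable (R ε))
    (hR : ∀ ε, 0 < ε → ∀ t, ‖R ε t‖ ≤ C * (ε / (t ^ 2 + ε ^ 2)))
    (hc : ∀ ε, 0 < ε → ∫ t, R ε t = c) :
    Tendsto (fun ε => ∫ y, g y * R ε (x - y)) (𝓝[>] 0) (𝓝 (g x * c)) := by
  have hRint : ∀ ε, 0 < ε → Integrable (R ε) := fun ε hε =>
    ((integrable_poisson hε).const_mul C).mono' (hm ε hε).aestronglyMeasurable
      (Eventually.of_forall (hR ε hε))
  -- Since each kernel has integral `c`, only the oscillation `g y - g x` has to be estimated.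
  have key : Tendsto (fun ε => ∫ y, (g y - g x) * R ε (x - y)) (𝓝[>] 0) (𝓝 0) := by
    have h := (hx.tendsto_integral_poisson hg).const_mul C
    rw [mul_zero] at h
    refine squeeze_zero_norm' ?_ h
    filter_upwards [self_mem_nhdsWithin] with ε (hε : 0 < ε)
    rw [← integral_const_mul]
    have hPint : Integrable fun y => ‖g y - g x‖ * (ε / ((x - y) ^ 2 + ε ^ 2)) := by
      have h1 : Integrable fun y => ‖g y‖ * (ε / ((x - y) ^ 2 + ε ^ 2)) := by
        refine hg.norm.mul_bdd (c := 1 / ε)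
          (Measurable.aestronglyMeasurable (by fun_prop)) (Eventually.of_forall fun y => ?_)
        rw [Real.norm_of_nonneg (by positivity), div_le_div_iff₀ (by positivity) hε]
        nlinarith [sq_nonneg (x - y)]
      have h2 : Integrable fun y => ‖g x‖ * (ε / ((x - y) ^ 2 + ε ^ 2)) :=
        ((integrable_poisson hε).comp_sub_left x).const_mul _
      refine (h1.add h2).mono' ((hg.aestronglyMeasurable.sub aestronglyMeasurable_const).norm.mul
        (Measurable.aestronglyMeasurable (by fun_prop))) (Eventually.of_forall fun y => ?_)
      have := norm_sub_le (g y) (g x)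
      simp only [Pi.add_apply]
      rw [Real.norm_of_nonneg (by positivity), ← add_mul]
      gcongr
    refine norm_integral_le_of_norm_le (hPint.const_mul C) (Eventually.of_forall fun y => ?_)
    rw [norm_mul, mul_left_comm]
    gcongr
    exact hR ε hε _
  have h2 := key.add_const (g x * c)
  rw [zero_add] at h2
  refine h2.congr' ?_
  filter_upwards [self_mem_nhdsWithin] with ε (hε : 0 < ε)
  have hRx := (hRint ε hε).comp_sub_left x
  have h3 : ∫ y, g x * R ε (x - y) = g x * c := by
    rw [integral_const_mul, integral_sub_left_eq_self (R ε) volume x, hc ε hε]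
  have hgR : Integrable fun y => g y * R ε (x - y) := by
    refine hg.mul_bdd (c := C * (1 / ε)) hRx.aestronglyMeasurable
      (Eventually.of_forall fun y => (hR ε hε _).trans ?_)
    have hC : 0 ≤ C := by
      have := (norm_nonneg _).trans (hR ε hε 0)
      exact nonneg_of_mul_nonneg_left this (by positivity)
    gcongr ?_ * ?_
    rw [div_le_div_iff₀ (by positivity) hε]
    nlinarith [sq_nonneg (x - y)]
  rw [← h3, ← integral_add _ (hRx.const_mul _)]
  · congr 1
    ext y
    ring
  · simp only [sub_mul]
    exact hgR.sub (hRx.const_mul _)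

namespace FreeQM

/-! ### The resolvent kernel `y ↦ (z - y)⁻¹` and the ladder operators -/

/-- The roots of `m² - z m + 1` have product 1, so one lies inside the unit disc unless both have
modulus 1; in that case they are conjugate and their sum `z` is real. -/
theorem exists_joukowsky {z : ℂ} (hz : z.im ≠ 0) : ∃ m : ℂ, m ≠ 0 ∧ ‖m‖ < 1 ∧ m + m⁻¹ = z := by
  obtain ⟨s, hs⟩ := IsAlgClosed.exists_pow_nat_eq (z ^ 2 - 4) (n := 2) (by norm_num)
  have hmul : ((z - s) / 2) * ((z + s) / 2) = 1 := by
    linear_combination (-1 / 4 : ℂ) * hs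
  have key : ∀ a b : ℂ, a * b = 1 → a + b = z → ‖a‖ < 1 → ∃ m : ℂ, m ≠ 0 ∧ ‖m‖ < 1 ∧ m + m⁻¹ = z :=
    fun a b hab hz ha =>
      ⟨a, left_ne_zero_of_mul_eq_one hab, ha, by rw [inv_eq_of_mul_eq_one_right hab, hz]⟩
  have hn : ‖(z - s) / 2‖ * ‖(z + s) / 2‖ = 1 := by rw [← norm_mul, hmul, norm_one]
  rcases lt_trichotomy ‖(z - s) / 2‖ 1 with h | h | h
  · exact key _ _ hmul (by ring) h
  · exfalso
    set a := (z - s) / 2 with ha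
    have h2 : a⁻¹ = (starRingEnd ℂ) a := Complex.inv_eq_conj h
    have h3 : a⁻¹ = (z + s) / 2 := inv_eq_of_mul_eq_one_right hmul
    have h4 : z = a + (starRingEnd ℂ) a := by rw [← h2, h3, ha]; ring
    apply hz
    rw [h4]
    simp
  · refine key _ _ ((mul_comm _ _).trans hmul) (by ring) ?_
    by_contra h'
    push Not at h'
    nlinarith

instance : IsFiniteMeasure semicircleLaw := by
  have h := integrable_semicircleLaw (f := fun _ => (1 : ℝ)) continuous_const
  rw [integrable_const_iff] at h
  exact h.resolve_left one_ne_zero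

theorem sub_ofReal_ne_zero {z : ℂ} (hz : z.im ≠ 0) (y : ℝ) : z - (y : ℂ) ≠ 0 := by
  intro h
  apply hz
  have := congrArg Complex.im h
  simpa using this

theorem norm_inv_sub_ofReal_le {z : ℂ} (hz : z.im ≠ 0) (y : ℝ) :
    ‖(z - (y : ℂ))⁻¹‖ ≤ |z.im|⁻¹ := by
  rw [norm_inv]
  refine inv_anti₀ (abs_pos.2 hz) ?_
  have := Complex.abs_im_le_norm (z - (y : ℂ))
  simpa using this

theorem memLp_resolvent {z : ℂ} (hz : z.im ≠ 0) :
    MemLp (fun y : ℝ => (z - (y : ℂ))⁻¹) 2 semicircleLaw :=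
  MemLp.of_bound (Measurable.aestronglyMeasurable (by fun_prop)) _
    (Eventually.of_forall (norm_inv_sub_ofReal_le hz))

/-- The kernel `y ↦ (z - y)⁻¹` as a vector of `L²(μ)`. -/
noncomputable def resolventVec {z : ℂ} (hz : z.im ≠ 0) : L2mu := (memLp_resolvent hz).toLp _

/-- The three-term recurrence makes the truncated generating series telescope, leaving two boundary
terms. -/
theorem sum_pow_mul_Phi {m : ℂ} (hm : m ≠ 0) (y : ℝ) (N : ℕ) :
    (m + m⁻¹ - y) * ∑ n ∈ Finset.range (N + 1), m ^ (n + 1) * (Phi n y : ℂ) =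
      1 - m ^ (N + 1) * (Phi (N + 1) y : ℂ) + m ^ (N + 2) * (Phi N y : ℂ) := by
  induction N with
  | zero =>
    simp only [zero_add, Finset.range_one, Finset.sum_singleton, Phi_zero, Phi_one]
    push_cast
    field_simp
    ring
  | succ N ih =>
    rw [Finset.sum_range_succ, mul_add, ih]
    have h : (y : ℂ) * (Phi (N + 1) y : ℂ) = (Phi (N + 2) y : ℂ) + (Phi N y : ℂ) := by
      exact_mod_cast Phi_recurrence N y
    have hi : m⁻¹ * m ^ (N + 2) = m ^ (N + 1) := by
      rw [pow_succ' m (N + 1), ← mul_assoc, inv_mul_cancel₀ hm, one_mul]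
    linear_combination (-m ^ (N + 2)) * h + (Phi (N + 1) y : ℂ) * hi

theorem norm_phi (n : ℕ) : ‖phi n‖ = 1 := orthonormal_phi.1 n

/-- The error of a partial sum is `(z - y)⁻¹` times the boundary terms of `sum_pow_mul_Phi`.
Bounding the first factor by `1/|Im z|` and using `‖Φ_n‖ = 1` in `L²` gives geometric decay, without
pointwise bounds on `Φ_n`. -/
theorem hasSum_resolventVec {z m : ℂ} (hz : z.im ≠ 0) (hm : m ≠ 0) (hm1 : ‖m‖ < 1)
    (hmz : m + m⁻¹ = z) : HasSum (fun n : ℕ => m ^ (n + 1) • phi n) (resolventVec hz) := by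
  have hs : Summable fun n : ℕ => m ^ (n + 1) • phi n := by
    refine Summable.of_norm ?_
    simp only [norm_smul, norm_phi, mul_one, norm_pow]
    exact (summable_nat_add_iff 1).2 (summable_geometric_of_lt_one (norm_nonneg _) hm1)
  rw [hs.hasSum_iff_tendsto_nat, ← tendsto_add_atTop_iff_nat 1, tendsto_iff_norm_sub_tendsto_zero]
  have hp : Tendsto (fun N : ℕ => |z.im|⁻¹ * (‖m‖ ^ (N + 1) + ‖m‖ ^ (N + 2))) atTop (𝓝 0) := by
    have h := tendsto_pow_atTop_nhds_zero_of_lt_one (norm_nonneg _) hm1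
    simpa using ((((tendsto_add_atTop_iff_nat 1).2 h).add ((tendsto_add_atTop_iff_nat 2).2 h))).const_mul
      (|z.im|⁻¹)
  refine squeeze_zero (fun _ => norm_nonneg _) (fun N => ?_) hp
  refine le_trans (b := |z.im|⁻¹ * ‖m ^ (N + 1) • phi (N + 1) - m ^ (N + 2) • phi N‖) ?_ ?_
  · apply Lp.norm_le_mul_norm_of_ae_le_mul
    have hall : ∀ᵐ y ∂semicircleLaw, ∀ n, phi n y = (Phi n y : ℂ) :=
      ae_all_iff.2 fun n => (memLp_Phi n).coeFn_toLp
    have hsum : ∀ N : ℕ, (∑ n ∈ Finset.range N, m ^ (n + 1) • phi n : L2mu) =ᵐ[semicircleLaw]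
        fun y => ∑ n ∈ Finset.range N, m ^ (n + 1) * (Phi n y : ℂ) := by
      intro N
      induction N with
      | zero =>
        filter_upwards [Lp.coeFn_zero ℂ 2 semicircleLaw] with y hy
        simpa using hy
      | succ N ih =>
        rw [Finset.sum_range_succ]
        filter_upwards [Lp.coeFn_add (∑ n ∈ Finset.range N, m ^ (n + 1) • phi n)
          (m ^ (N + 1) • phi N), ih, Lp.coeFn_smul (m ^ (N + 1)) (phi N), hall] with y h1 h2 h3 h4
        rw [h1, Pi.add_apply, h2, h3, Finset.sum_range_succ, Pi.smul_apply, h4, smul_eq_mul]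
    filter_upwards [Lp.coeFn_sub (∑ n ∈ Finset.range (N + 1), m ^ (n + 1) • phi n)
      (resolventVec hz), hsum (N + 1), hall, (memLp_resolvent hz).coeFn_toLp,
      Lp.coeFn_sub (m ^ (N + 1) • phi (N + 1)) (m ^ (N + 2) • phi N),
      Lp.coeFn_smul (m ^ (N + 1)) (phi (N + 1)), Lp.coeFn_smul (m ^ (N + 2)) (phi N)]
      with y h1 h2 h3 h4 h5 h6 h7
    rw [h1, h5, Pi.sub_apply, Pi.sub_apply, h6, h7, h2]
    simp only [resolventVec]
    rw [h4, Pi.smul_apply, Pi.smul_apply, h3, h3, smul_eq_mul, smul_eq_mul]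
    have hzy := sub_ofReal_ne_zero hz y
    have hid := sum_pow_mul_Phi hm y N
    rw [hmz] at hid
    have : ∑ n ∈ Finset.range (N + 1), m ^ (n + 1) * (Phi n y : ℂ) - (z - (y : ℂ))⁻¹ =
        -((z - (y : ℂ))⁻¹ * (m ^ (N + 1) * (Phi (N + 1) y : ℂ) - m ^ (N + 2) * (Phi N y : ℂ))) := by
      refine mul_left_cancel₀ hzy ?_
      rw [mul_sub, hid, mul_inv_cancel₀ hzy, mul_neg, ← mul_assoc, mul_inv_cancel₀ hzy]
      ring
    rw [this, norm_neg, norm_mul]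
    gcongr
    exact norm_inv_sub_ofReal_le hz y
  · gcongr
    refine (norm_sub_le _ _).trans ?_
    simp [norm_smul, norm_phi]

theorem annihilation_resolventVec {z m : ℂ} (hz : z.im ≠ 0) (hm : m ≠ 0) (hm1 : ‖m‖ < 1)
    (hmz : m + m⁻¹ = z) : annihilation (resolventVec hz) = m • resolventVec hz := by
  have h := hasSum_resolventVec hz hm hm1 hmz
  have h1 := (hasSum_nat_add_iff' 1).2 (annihilation.hasSum h)
  simp only [map_smul, annihilation_phi_succ, Finset.range_one, Finset.sum_singleton,
    annihilation_phi_zero, smul_zero, sub_zero] at h1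
  refine h1.unique ((h.const_smul m).congr_fun fun n => ?_)
  rw [smul_smul, pow_succ' m (n + 1)]

/-- Shifting up and multiplying by `m` reproduces the series without its term `m Φ_0`. -/
theorem creation_resolventVec {z m : ℂ} (hz : z.im ≠ 0) (hm : m ≠ 0) (hm1 : ‖m‖ < 1)
    (hmz : m + m⁻¹ = z) : creation (resolventVec hz) = m⁻¹ • resolventVec hz - phi 0 := by
  have h := hasSum_resolventVec hz hm hm1 hmz
  have h1 := (creation.hasSum h).const_smul m
  have h2 := (hasSum_nat_add_iff' 1).2 h
  simp only [map_smul, creation_phi, smul_smul, ← pow_succ'] at h1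
  simp only [Finset.range_one, Finset.sum_singleton, zero_add, pow_one] at h2
  have h3 := h1.unique h2
  rw [← inv_smul_smul₀ hm (creation (resolventVec hz)), h3, smul_sub, inv_smul_smul₀ hm]

/-! ### Duality and the functional equation of the Cauchy transform -/

theorem inner_creation_left (f g : L2mu) :
    inner ℂ (creation f) g = inner ℂ f (annihilation g) := by
  simp only [creation, annihilation, ContinuousLinearMap.comp_apply]
  rw [← ContinuousLinearMap.adjoint_inner_right, ContinuousLinearMap.adjoint_inner_left]

theorem inner_annihilation_left (f g : L2mu) :
    inner ℂ (annihilation f) g = inner ℂ f (creation g) := by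
  rw [← inner_conj_symm, ← inner_creation_left, inner_conj_symm]

/-- The operator `a⁺ - a`, so that `P_X = i (a⁺ - a)`. -/
noncomputable def ladderDiff : L2mu →L[ℂ] L2mu := creation - annihilation

/-- The Cauchy transform of `f μ`. -/
noncomputable def cauchyTransform (f : ℝ → ℂ) (z : ℂ) : ℂ :=
  ∫ y, f y / (z - (y : ℂ)) ∂semicircleLaw

theorem inner_resolventVec {z : ℂ} (hz : ((starRingEnd ℂ) z).im ≠ 0) (f : L2mu) :
    inner ℂ (resolventVec hz) f = cauchyTransform f z := by
  rw [L2.inner_def, cauchyTransform]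
  refine integral_congr_ae ?_
  filter_upwards [(memLp_resolvent hz).coeFn_toLp] with y hy
  simp only [resolventVec]
  rw [hy]
  simp [div_eq_mul_inv]

theorem inner_phi_zero (f : L2mu) : inner ℂ (phi 0) f = ∫ y, f y ∂semicircleLaw := by
  rw [L2.inner_def]
  refine integral_congr_ae ?_
  filter_upwards [(memLp_Phi 0).coeFn_toLp] with y hy
  simp only [phi]
  rw [hy]
  simp [Phi_zero]

/-- `a⁺ - a` is skew-adjoint, so it can be moved onto the resolvent vector. The inner product is
conjugate-linear on the left, hence the vector is taken at `conj z`, with parameter `conj m`. -/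
theorem cauchyTransform_ladderDiff {z m : ℂ} (hz : z.im ≠ 0) (hm : m ≠ 0) (hm1 : ‖m‖ < 1)
    (hmz : m + m⁻¹ = z) (f : L2mu) :
    (m⁻¹ - m) * cauchyTransform f z =
      (∫ y, f y ∂semicircleLaw) - cauchyTransform (ladderDiff f) z := by
  have hz' : ((starRingEnd ℂ) z).im ≠ 0 := by simpa using hz
  have hm' : (starRingEnd ℂ) m ≠ 0 := by simpa using hm
  have hm1' : ‖(starRingEnd ℂ) m‖ < 1 := by simpa using hm1
  have hmz' : (starRingEnd ℂ) m + ((starRingEnd ℂ) m)⁻¹ = (starRingEnd ℂ) z := by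
    rw [← hmz]; simp
  rw [← inner_resolventVec hz', ← inner_resolventVec hz', ← inner_phi_zero, ladderDiff,
    sub_apply, inner_sub_right, ← inner_annihilation_left,
    ← inner_creation_left, annihilation_resolventVec hz' hm' hm1' hmz',
    creation_resolventVec hz' hm' hm1' hmz', inner_sub_left, inner_smul_left, inner_smul_left]
  simp only [map_inv₀, Complex.conj_conj]
  ring

/-! ### Boundary behaviour of the Cauchy transform -/

/-- The function `f` times the Lebesgue density of the semicircle law. -/
noncomputable def weighted (f : ℝ → ℂ) (y : ℝ) : ℂ :=
  ((√(4 - y ^ 2) / (2 * Real.pi) : ℝ) : ℂ) * f y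

theorem integral_semicircleLaw_complex (f : ℝ → ℂ) :
    ∫ y, f y ∂semicircleLaw = ∫ y, weighted f y := by
  rw [semicircleLaw, integral_withDensity_eq_integral_toReal_smul (by fun_prop) (by simp)]
  refine integral_congr_ae (Eventually.of_forall fun y => ?_)
  simp only [weighted]
  rw [ENNReal.toReal_ofReal (by positivity), Complex.real_smul]

theorem integrable_weighted {f : ℝ → ℂ} (hf : Integrable f semicircleLaw) :
    Integrable (weighted f) := by
  rw [semicircleLaw, integrable_withDensity_iff_integrable_smul' (by fun_prop) (by simp)] at hf
  refine hf.congr (Eventually.of_forall fun y => ?_)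
  simp only [weighted]
  rw [ENNReal.toReal_ofReal (by positivity), Complex.real_smul]

theorem integrable_cauchy {f : ℝ → ℂ} (hf : Integrable f semicircleLaw) {z : ℂ} (hz : z.im ≠ 0) :
    Integrable (fun y : ℝ => f y / (z - (y : ℂ))) semicircleLaw := by
  simp only [div_eq_mul_inv]
  exact hf.mul_bdd (Measurable.aestronglyMeasurable (by fun_prop))
    (Eventually.of_forall (norm_inv_sub_ofReal_le hz))

theorem integrableOn_truncated {f : ℝ → ℂ} (hf : Integrable f semicircleLaw) (x : ℝ) {ε : ℝ}
    (hε : 0 < ε) :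
    IntegrableOn (fun y : ℝ => f y / ((x : ℂ) - (y : ℂ))) {y | ε < |x - y|} semicircleLaw := by
  simp only [div_eq_mul_inv]
  refine hf.integrableOn.mul_bdd (c := ε⁻¹) (Measurable.aestronglyMeasurable (by fun_prop)) ?_
  refine (ae_restrict_iff' (measurableSet_lt (by fun_prop) (by fun_prop))).2
    (Eventually.of_forall fun y hy => ?_)
  rw [← Complex.ofReal_sub, norm_inv, Complex.norm_real, Real.norm_eq_abs]
  exact inv_anti₀ hε (le_of_lt hy)

theorem im_add_mul_I (x ε : ℝ) : ((x : ℂ) + ε * Complex.I).im = ε := by simp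

theorem im_sub_mul_I (x ε : ℝ) : ((x : ℂ) - ε * Complex.I).im = -ε := by simp

theorem sq_add_sq_ne_zero {ε : ℝ} (hε : 0 < ε) (t : ℝ) : ((t : ℂ) ^ 2 + (ε : ℂ) ^ 2) ≠ 0 := by
  have : t ^ 2 + ε ^ 2 ≠ 0 := by positivity
  exact_mod_cast this

theorem inv_add_mul_I {ε : ℝ} (hε : 0 < ε) (t : ℝ) :
    ((t : ℂ) + ε * Complex.I)⁻¹ = (t - ε * Complex.I) / ((t : ℂ) ^ 2 + (ε : ℂ) ^ 2) := by
  refine inv_eq_of_mul_eq_one_right ?_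
  rw [mul_div_assoc', div_eq_one_iff_eq (sq_add_sq_ne_zero hε t)]
  linear_combination (-(ε : ℂ) ^ 2) * Complex.I_sq

theorem inv_sub_mul_I {ε : ℝ} (hε : 0 < ε) (t : ℝ) :
    ((t : ℂ) - ε * Complex.I)⁻¹ = (t + ε * Complex.I) / ((t : ℂ) ^ 2 + (ε : ℂ) ^ 2) := by
  refine inv_eq_of_mul_eq_one_right ?_
  rw [mul_div_assoc', div_eq_one_iff_eq (sq_add_sq_ne_zero hε t)]
  linear_combination (-(ε : ℂ) ^ 2) * Complex.I_sq

/-- The jump of the Cauchy transform across the real axis. -/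
theorem tendsto_cauchyTransform_sub {f : ℝ → ℂ} (hf : Integrable f semicircleLaw) {x : ℝ}
    (hx : IsLebesguePoint (weighted f) x) :
    Tendsto (fun ε : ℝ => cauchyTransform f (x + ε * Complex.I) -
      cauchyTransform f (x - ε * Complex.I)) (𝓝[>] 0)
      (𝓝 (weighted f x * (-2 * Complex.I * Real.pi))) := by
  have h := hx.tendsto_integral_kernel (integrable_weighted hf) (C := 2)
    (R := fun ε t => -2 * Complex.I * ((ε / (t ^ 2 + ε ^ 2) : ℝ) : ℂ))
    (c := -2 * Complex.I * Real.pi)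
    (fun ε hε => by fun_prop) (fun ε hε t => ?_) (fun ε hε => ?_)
  · refine h.congr' ?_
    filter_upwards [self_mem_nhdsWithin] with ε (hε : 0 < ε)
    rw [cauchyTransform, cauchyTransform, ← integral_sub
      (integrable_cauchy hf (by rw [im_add_mul_I]; exact hε.ne'))
      (integrable_cauchy hf (by rw [im_sub_mul_I]; exact neg_ne_zero.2 hε.ne')),
      integral_semicircleLaw_complex]
    refine integral_congr_ae (Eventually.of_forall fun y => ?_)
    dsimp only
    simp only [weighted]
    rw [mul_assoc]
    congr 1
    have e1 : (x : ℂ) + ε * Complex.I - y = ((x - y : ℝ) : ℂ) + ε * Complex.I := by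
      push_cast; ring
    have e2 : (x : ℂ) - ε * Complex.I - y = ((x - y : ℝ) : ℂ) - ε * Complex.I := by
      push_cast; ring
    rw [e1, e2, div_eq_mul_inv (f y), div_eq_mul_inv (f y), inv_add_mul_I hε, inv_sub_mul_I hε]
    push_cast
    ring
  · rw [norm_mul, Complex.norm_real, Real.norm_of_nonneg (by positivity)]
    simp
  · rw [integral_const_mul, integral_complex_ofReal, integral_poisson hε]

open Classical in
/-- The difference between the conjugate Poisson kernel and the truncated kernel `2 / t`. -/
noncomputable def truncationKernel (ε t : ℝ) : ℝ :=
  2 * t / (t ^ 2 + ε ^ 2) - if ε < |t| then 2 / t else 0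

theorem measurable_truncationKernel (ε : ℝ) : Measurable (truncationKernel ε) := by
  unfold truncationKernel
  refine Measurable.sub (by fun_prop) (Measurable.ite ?_ (by fun_prop) measurable_const)
  exact measurableSet_lt (by fun_prop) (by fun_prop)

/-- For `|t| > ε` the `2/t` tails cancel to `-2ε² / (t (t² + ε²))`, and `ε/|t| ≤ 1`; for `|t| ≤ ε`
only the conjugate Poisson kernel remains. -/
theorem abs_truncationKernel_le {ε : ℝ} (hε : 0 < ε) (t : ℝ) :
    |truncationKernel ε t| ≤ 2 * (ε / (t ^ 2 + ε ^ 2)) := by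
  unfold truncationKernel
  have hp : 0 < t ^ 2 + ε ^ 2 := by positivity
  split_ifs with h
  · have ht : t ≠ 0 := fun h0 => by rw [h0, abs_zero] at h; linarith
    have e : 2 * t / (t ^ 2 + ε ^ 2) - 2 / t = (2 * ε) * (-ε / t) / (t ^ 2 + ε ^ 2) := by
      field_simp
      ring
    rw [e, abs_div, abs_mul, abs_of_pos hp, abs_of_pos (by positivity : 0 < 2 * ε), mul_div_assoc',
      abs_div, abs_neg, abs_of_pos hε]
    have : ε / |t| ≤ 1 := (div_le_one (by linarith)).2 h.le
    gcongr ?_ / _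
    nlinarith
  · push Not at h
    rw [sub_zero, abs_div, abs_of_pos hp, abs_mul, abs_two, mul_div_assoc']
    gcongr

theorem integral_truncationKernel (ε : ℝ) : ∫ t, truncationKernel ε t = 0 := by
  have h := integral_neg_eq_self (truncationKernel ε) volume
  have h2 : ∀ t, truncationKernel ε (-t) = -truncationKernel ε t := by
    intro t
    unfold truncationKernel
    rw [abs_neg, neg_sq]
    split_ifs <;> ring
  simp only [h2] at h
  rw [integral_neg] at h
  linarith

/-- With `t = x - y`, `1/(t + iε) + 1/(t - iε) = 2t/(t² + ε²)`, so the integrand is `weighted f`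
against `truncationKernel`, whose integral vanishes by oddness. -/
theorem tendsto_cauchyTransform_add_sub_truncated {f : ℝ → ℂ} (hf : Integrable f semicircleLaw)
    {x : ℝ} (hx : IsLebesguePoint (weighted f) x) :
    Tendsto (fun ε : ℝ => cauchyTransform f (x + ε * Complex.I) +
      cauchyTransform f (x - ε * Complex.I) -
      2 * ∫ y in {y : ℝ | ε < |x - y|}, f y / ((x : ℂ) - (y : ℂ)) ∂semicircleLaw) (𝓝[>] 0)
      (𝓝 0) := by
  have h := hx.tendsto_integral_kernel (integrable_weighted hf) (C := 2)
    (R := fun ε t => (truncationKernel ε t : ℂ)) (c := 0)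
    (fun ε hε => Complex.measurable_ofReal.comp (measurable_truncationKernel ε))
    (fun ε hε t => by
      rw [Complex.norm_real]
      exact abs_truncationKernel_le hε t)
    (fun ε hε => by rw [integral_complex_ofReal, integral_truncationKernel, Complex.ofReal_zero])
  rw [mul_zero] at h
  refine h.congr' ?_
  filter_upwards [self_mem_nhdsWithin] with ε (hε : 0 < ε)
  have hms : MeasurableSet {y : ℝ | ε < |x - y|} := measurableSet_lt (by fun_prop) (by fun_prop)
  have hi1 := integrable_cauchy hf (z := x + ε * Complex.I) (by rw [im_add_mul_I]; exact hε.ne')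
  have hi2 := integrable_cauchy hf (z := x - ε * Complex.I)
    (by rw [im_sub_mul_I]; exact neg_ne_zero.2 hε.ne')
  have hi12 : Integrable (fun y : ℝ => f y / (x + ε * Complex.I - (y : ℂ)) +
      f y / (x - ε * Complex.I - (y : ℂ))) semicircleLaw := hi1.add hi2
  rw [cauchyTransform, cauchyTransform, ← integral_add hi1 hi2, ← integral_indicator hms,
    ← integral_const_mul, ← integral_sub hi12
      (((integrableOn_truncated hf x hε).integrable_indicator hms).const_mul 2),
    integral_semicircleLaw_complex]
  refine integral_congr_ae (Eventually.of_forall fun y => ?_)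
  dsimp only
  simp only [weighted]
  rw [mul_assoc]
  congr 1
  have e1 : (x : ℂ) + ε * Complex.I - y = ((x - y : ℝ) : ℂ) + ε * Complex.I := by
    push_cast; ring
  have e2 : (x : ℂ) - ε * Complex.I - y = ((x - y : ℝ) : ℂ) - ε * Complex.I := by
    push_cast; ring
  rw [e1, e2, div_eq_mul_inv, div_eq_mul_inv, inv_add_mul_I hε, inv_sub_mul_I hε]
  by_cases hy : ε < |x - y|
  · rw [Set.indicator_of_mem (by exact hy), truncationKernel, if_pos hy]
    push_cast
    ring
  · rw [Set.indicator_of_notMem (by exact hy), truncationKernel, if_neg hy]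
    push_cast
    ring

/-! ### Boundary limit of the functional equation -/

theorem ae_ne (x : ℝ) : ∀ᵐ y ∂semicircleLaw, y ≠ x := by
  have h : ∀ᵐ y ∂(volume : Measure ℝ), y ≠ x := by simp [ae_iff]
  exact (withDensity_absolutelyContinuous _ _).ae_le h

/-- Dominated convergence: `ε / (x + εu - y)` is bounded by 1 and tends to 0 off the null set `{x}`.
-/
theorem tendsto_mul_cauchyTransform {f : ℝ → ℂ} (hf : Integrable f semicircleLaw) (x : ℝ)
    {u : ℂ} (hu : |u.im| = 1) :
    Tendsto (fun ε : ℝ => ε * cauchyTransform f (x + ε * u)) (𝓝[>] 0) (𝓝 0) := by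
  simp only [cauchyTransform, ← integral_const_mul]
  rw [show (0 : ℂ) = ∫ y : ℝ, (0 : ℂ) ∂semicircleLaw by simp]
  refine tendsto_integral_filter_of_dominated_convergence (fun y => ‖f y‖) ?_ ?_ hf.norm ?_
  · refine Eventually.of_forall fun ε => ?_
    simp only [div_eq_mul_inv]
    exact (hf.aestronglyMeasurable.mul
      (Measurable.aestronglyMeasurable (by fun_prop))).const_mul _
  · filter_upwards [self_mem_nhdsWithin] with ε (hε : 0 < ε)
    refine Eventually.of_forall fun y => ?_
    have him : ((x : ℂ) + ε * u).im = ε * u.im := by simp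
    have hne : ((x : ℂ) + ε * u).im ≠ 0 := by
      rw [him]
      refine mul_ne_zero hε.ne' fun h => ?_
      rw [h, abs_zero] at hu
      exact zero_ne_one hu
    have h := norm_inv_sub_ofReal_le hne y
    rw [him, abs_mul, hu, mul_one, abs_of_pos hε] at h
    rw [div_eq_mul_inv, norm_mul, norm_mul, Complex.norm_real, Real.norm_of_nonneg hε.le]
    calc ε * (‖f y‖ * ‖((x : ℂ) + ε * u - y)⁻¹‖) ≤ ε * (‖f y‖ * ε⁻¹) := by gcongr
      _ = ‖f y‖ := by field_simp
  · filter_upwards [ae_ne x] with y hy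
    have hxy : (x : ℂ) + (0 : ℝ) * u - y ≠ 0 := by
      rw [Complex.ofReal_zero, zero_mul, add_zero, sub_ne_zero]
      exact_mod_cast hy.symm
    have hc : ContinuousAt (fun ε : ℝ => (ε : ℂ) * (f y / ((x : ℂ) + ε * u - y))) 0 := by
      refine ContinuousAt.mul (by fun_prop) (ContinuousAt.div continuousAt_const ?_ hxy)
      fun_prop
    have h := hc.tendsto
    rw [Complex.ofReal_zero, zero_mul] at h
    exact tendsto_nhdsWithin_of_tendsto_nhds h

/-- Let `s = 1/m - m` and `σ = √(4 - x²)`. Then `s² = z² - 4`, so `(s - iσ)(s + iσ) = ε(2ix - ε)`.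
The branch is fixed by `|m| < 1`: it forces `Im m < 0`, hence `Im s ≥ 0` and `|s + iσ| ≥ σ`. The
linear rate in `ε` matters later. -/
theorem norm_joukowsky_sub_le {x ε : ℝ} (hx : 0 < 4 - x ^ 2) (hε : 0 < ε) {m : ℂ}
    (hm : m ≠ 0) (hm1 : ‖m‖ < 1) (hmz : m + m⁻¹ = x + ε * Complex.I) :
    ‖m⁻¹ - m - √(4 - x ^ 2) * Complex.I‖ ≤ ε * (4 + ε) / √(4 - x ^ 2) := by
  set σ := √(4 - x ^ 2) with hσ
  have hσ0 : 0 < σ := Real.sqrt_pos.2 hx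
  have hσ2 : (σ : ℂ) ^ 2 = 4 - x ^ 2 := by
    exact_mod_cast Real.sq_sqrt hx.le
  have hn0 : 0 < Complex.normSq m := Complex.normSq_pos.2 hm
  have hn1 : Complex.normSq m < 1 := by
    rw [Complex.normSq_eq_norm_sq]
    nlinarith [norm_nonneg m]
  have him : m.im - m.im / Complex.normSq m = ε := by
    have := congrArg Complex.im hmz
    simpa [neg_div, sub_eq_add_neg] using this
  have hmim : m.im < 0 := by
    by_contra h
    push Not at h
    have : m.im ≤ m.im / Complex.normSq m := by
      rw [le_div_iff₀ hn0]
      nlinarith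
    linarith
  have hsim : 0 ≤ (m⁻¹ - m).im := by
    have h : (m⁻¹ - m).im = ε - 2 * m.im := by
      simp only [Complex.sub_im, Complex.inv_im, neg_div]
      linarith
    rw [h]
    linarith
  have hlow : σ ≤ ‖m⁻¹ - m + σ * Complex.I‖ := by
    refine le_trans ?_ (Complex.abs_im_le_norm _)
    refine le_trans ?_ (le_abs_self _)
    simpa using hsim
  have hmi : m * m⁻¹ = 1 := mul_inv_cancel₀ hm
  have hprod : (m⁻¹ - m - σ * Complex.I) * (m⁻¹ - m + σ * Complex.I) =
      ε * (2 * x * Complex.I - ε) := by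
    linear_combination (m + m⁻¹ + x + ε * Complex.I) * hmz - 4 * hmi + hσ2 +
      ((ε : ℂ) ^ 2 - (σ : ℂ) ^ 2) * Complex.I_sq
  have hup : ‖m⁻¹ - m - σ * Complex.I‖ * ‖m⁻¹ - m + σ * Complex.I‖ ≤ ε * (4 + ε) := by
    rw [← norm_mul, hprod, norm_mul, Complex.norm_real, Real.norm_of_nonneg hε.le]
    gcongr
    refine (norm_sub_le _ _).trans ?_
    have hx2 : |x| ≤ 2 := abs_le_of_sq_le_sq (by linarith) (by norm_num)
    simp only [norm_mul, Complex.norm_I, Complex.norm_real, Real.norm_eq_abs, abs_of_pos hε,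
      Complex.norm_ofNat, mul_one]
    linarith
  rw [le_div_iff₀ hσ0]
  exact le_trans (by gcongr) hup

theorem integrable_coeFn (f : L2mu) : Integrable f semicircleLaw :=
  (Lp.memLp f).integrable (by norm_num)

/-- The boundary values of the conjugate Cauchy transform of `f μ` are those of `a⁺ - a`. -/
theorem tendsto_cauchyTransform_add (f : L2mu) {x : ℝ} (hx : 0 < 4 - x ^ 2)
    (hL : IsLebesguePoint (weighted (ladderDiff f)) x) :
    Tendsto (fun ε : ℝ => cauchyTransform f (x + ε * Complex.I) +
      cauchyTransform f (x - ε * Complex.I)) (𝓝[>] 0) (𝓝 (ladderDiff f x)) := by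
  set σ := √(4 - x ^ 2) with hσ
  have hσ0 : 0 < σ := Real.sqrt_pos.2 hx
  have hσC : (σ : ℂ) ≠ 0 := by exact_mod_cast hσ0.ne'
  have hex : ∀ ε : ℝ, ∃ m : ℂ, 0 < ε → m ≠ 0 ∧ ‖m‖ < 1 ∧ m + m⁻¹ = x + ε * Complex.I := by
    intro ε
    by_cases hε : 0 < ε
    · obtain ⟨m, hm⟩ := exists_joukowsky (z := x + ε * Complex.I)
        (by rw [im_add_mul_I]; exact hε.ne')
      exact ⟨m, fun _ => hm⟩
    · exact ⟨0, fun h => absurd h hε⟩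
  choose m hm using hex
  set s : ℝ → ℂ := fun ε => (m ε)⁻¹ - m ε with hs
  set q : ℝ → ℂ := fun ε => s ε + (starRingEnd ℂ) (s ε) with hq
  set h := ladderDiff f with hh
  set C := ∫ y, f y ∂semicircleLaw with hC
  set A : ℝ → ℂ := fun ε => cauchyTransform h (x + ε * Complex.I) +
    cauchyTransform h (x - ε * Complex.I) with hA
  have hsb : ∀ ε, 0 < ε → ‖s ε - σ * Complex.I‖ ≤ ε * (4 + ε) / σ := fun ε hε =>
    norm_joukowsky_sub_le hx hε (hm ε hε).1 (hm ε hε).2.1 (hm ε hε).2.2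
  have hslim : Tendsto s (𝓝[>] 0) (𝓝 (σ * Complex.I)) := by
    rw [tendsto_iff_norm_sub_tendsto_zero]
    refine squeeze_zero' (Eventually.of_forall fun _ => norm_nonneg _) ?_
      (tendsto_nhdsWithin_of_tendsto_nhds
        (Continuous.tendsto' (f := fun ε : ℝ => ε * (4 + ε) / σ) (by fun_prop) 0 0 (by simp)))
    filter_upwards [self_mem_nhdsWithin] with ε hε using hsb ε hε
  have hs'lim : Tendsto (fun ε => (starRingEnd ℂ) (s ε)) (𝓝[>] 0) (𝓝 (-(σ * Complex.I))) := by
    have := (Complex.continuous_conj.tendsto _).comp hslim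
    simpa [Function.comp_def] using this
  have hqlim : Tendsto q (𝓝[>] 0) (𝓝 0) := by
    have := hslim.add hs'lim
    rwa [add_neg_cancel] at this
  have hqb : ∀ ε, 0 < ε → ‖q ε‖ ≤ ε * (2 * (4 + ε) / σ) := by
    intro ε hε
    have e : q ε = (s ε - σ * Complex.I) + (starRingEnd ℂ) (s ε - σ * Complex.I) := by
      simp only [hq, map_sub, map_mul, Complex.conj_I, Complex.conj_ofReal]
      ring
    rw [e]
    refine (norm_add_le _ _).trans ?_
    rw [Complex.norm_conj]
    have := hsb ε hε
    calc _ ≤ ε * (4 + ε) / σ + ε * (4 + ε) / σ := by gcongr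
      _ = _ := by ring
  have hhi : Integrable h semicircleLaw := integrable_coeFn _
  have hεA : Tendsto (fun ε : ℝ => (ε : ℂ) * A ε) (𝓝[>] 0) (𝓝 0) := by
    have h1 := tendsto_mul_cauchyTransform hhi x (u := Complex.I) (by simp)
    have h2 := tendsto_mul_cauchyTransform hhi x (u := -Complex.I) (by simp)
    have h3 := h1.add h2
    simpa only [← mul_add, mul_neg, ← sub_eq_add_neg, add_zero] using h3
  -- `A` is not known to converge; `q = O(ε)` and `ε A → 0` suffice.
  have hqA : Tendsto (fun ε : ℝ => q ε * A ε) (𝓝[>] 0) (𝓝 0) := by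
    have hb : Tendsto (fun ε : ℝ => 2 * (4 + ε) / σ * ‖(ε : ℂ) * A ε‖) (𝓝[>] 0) (𝓝 0) := by
      have h1 : Tendsto (fun ε : ℝ => 2 * (4 + ε) / σ) (𝓝[>] 0) (𝓝 (2 * (4 + 0) / σ)) :=
        tendsto_nhdsWithin_of_tendsto_nhds (Continuous.tendsto (by fun_prop) 0)
      simpa using h1.mul hεA.norm
    refine squeeze_zero_norm' ?_ hb
    filter_upwards [self_mem_nhdsWithin] with ε (hε : 0 < ε)
    rw [norm_mul, norm_mul, Complex.norm_real, Real.norm_of_nonneg hε.le, ← mul_assoc,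
      mul_comm _ ε]
    gcongr
    exact hqb ε hε
  have hBlim := tendsto_cauchyTransform_sub hhi hL
  have hden : Tendsto (fun ε => s ε * (starRingEnd ℂ) (s ε)) (𝓝[>] 0) (𝓝 ((σ : ℂ) ^ 2)) := by
    have := hslim.mul hs'lim
    have e : (σ : ℂ) * Complex.I * -(σ * Complex.I) = (σ : ℂ) ^ 2 := by
      linear_combination (-(σ : ℂ) ^ 2) * Complex.I_sq
    rwa [e] at this
  -- Write `B` for the jump of the Cauchy transform of `h`. Solving the equations at `x ± iε` and
  -- splitting the values of that transform into half-sum and half-difference gives `(C q - q A/2 -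
  -- B (conj s - s)/2) / (s conj s)`.
  have hmain := (((hqlim.const_mul C).sub (hqA.div_const 2)).sub
    ((hBlim.mul (hs'lim.sub hslim)).div_const 2)).div hden (pow_ne_zero 2 hσC)
  have hval : (C * 0 - 0 / 2 - weighted h x * (-2 * Complex.I * Real.pi) *
      (-(σ * Complex.I) - σ * Complex.I) / 2) / (σ : ℂ) ^ 2 = h x := by
    have hpi : (Real.pi : ℂ) ≠ 0 := by exact_mod_cast Real.pi_ne_zero
    simp only [weighted, ← hσ]
    push_cast
    rw [div_eq_iff (pow_ne_zero 2 hσC)]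
    field_simp
    linear_combination (-2 * (σ : ℂ) ^ 2 * h x) * Complex.I_sq
  rw [hval] at hmain
  refine hmain.congr' ?_
  have hsne := hslim.eventually_ne (mul_ne_zero hσC Complex.I_ne_zero)
  filter_upwards [self_mem_nhdsWithin, hsne] with ε (hε : 0 < ε) hs0
  obtain ⟨hm0, hm1, hmz⟩ := hm ε hε
  have hs0' : (starRingEnd ℂ) (s ε) ≠ 0 := by simpa using hs0
  have k1 := cauchyTransform_ladderDiff (by rw [im_add_mul_I]; exact hε.ne') hm0 hm1 hmz f
  have hmz' : (starRingEnd ℂ) (m ε) + ((starRingEnd ℂ) (m ε))⁻¹ = x - ε * Complex.I := by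
    rw [← map_inv₀, ← map_add, hmz]
    simp [sub_eq_add_neg]
  have k2 := cauchyTransform_ladderDiff (by rw [im_sub_mul_I]; exact neg_ne_zero.2 hε.ne')
    (by simpa using hm0) (by simpa using hm1) hmz' f
  rw [← map_inv₀, ← map_sub] at k2
  rw [Pi.div_apply, div_eq_iff (mul_ne_zero hs0 hs0')]
  simp only [hq, hA]
  change s ε * _ = C - cauchyTransform h _ at k1
  change (starRingEnd ℂ) (s ε) * _ = C - cauchyTransform h _ at k2
  linear_combination (-(starRingEnd ℂ) (s ε)) * k1 - s ε * k2

/-! ### The Hilbert transform -/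

theorem HasMuHilbertAt.muHilbert_eq {f : ℝ → ℂ} {x : ℝ} {L : ℂ} (h : HasMuHilbertAt f x L) :
    muHilbert f x = L := by
  have hex : ∃ L, HasMuHilbertAt f x L := ⟨L, h⟩
  rw [muHilbert, dif_pos hex]
  exact tendsto_nhds_unique hex.choose_spec.2 h.2

/-- Needed to iterate: `muHilbert f` is only almost everywhere equal to an `L²` representative. -/
theorem HasMuHilbertAt.congr_ae {f g : ℝ → ℂ} {x : ℝ} {L : ℂ} (h : HasMuHilbertAt f x L)
    (hfg : f =ᵐ[semicircleLaw] g) : HasMuHilbertAt g x L := by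
  have key : ∀ ε : ℝ, (fun y : ℝ => f y / ((x : ℂ) - (y : ℂ)))
      =ᵐ[semicircleLaw.restrict {y | ε < |x - y|}] fun y => g y / ((x : ℂ) - (y : ℂ)) := by
    intro ε
    filter_upwards [ae_restrict_of_ae hfg] with y hy
    rw [hy]
  refine ⟨fun ε hε => (h.1 ε hε).congr (key ε), h.2.congr fun ε => ?_⟩
  rw [integral_congr_ae (key ε)]

theorem ae_hasMuHilbertAt (f : L2mu) :
    ∀ᵐ x ∂semicircleLaw, HasMuHilbertAt f x (ladderDiff f x) := by
  refine (ae_withDensity_iff (by fun_prop)).2 ?_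
  filter_upwards [ae_isLebesguePoint (integrable_weighted (integrable_coeFn f)),
    ae_isLebesguePoint (integrable_weighted (integrable_coeFn (ladderDiff f)))] with x h1 h2 hx
  -- Almost everywhere for `μ` concerns only points of nonzero density, which excludes the endpoints
  -- `±2`.
  have hpos : 0 < 4 - x ^ 2 := by
    by_contra h
    apply hx
    rw [Real.sqrt_eq_zero_of_nonpos (not_lt.1 h)]
    simp
  refine ⟨fun ε hε => integrableOn_truncated (integrable_coeFn f) x hε, ?_⟩
  have h := (tendsto_cauchyTransform_add f hpos h2).sub
    (tendsto_cauchyTransform_add_sub_truncated (integrable_coeFn f) h1)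
  rw [sub_zero] at h
  exact h.congr fun ε => sub_sub_cancel _ _

theorem muHilbert_ae_eq (f : L2mu) : muHilbert f =ᵐ[semicircleLaw] ladderDiff f := by
  filter_upwards [ae_hasMuHilbertAt f] with x hx using hx.muHilbert_eq

theorem momentum_apply (f : L2mu) : momentum f = Complex.I • ladderDiff f := rfl

theorem kineticEnergy_apply (f : L2mu) :
    kineticEnergy f = (-(1 / 2) : ℂ) • ladderDiff (ladderDiff f) := by
  change (1 / 2 : ℂ) • (momentum (momentum f)) = _
  rw [momentum_apply, momentum_apply, map_smul, smul_smul, smul_smul, mul_assoc, Complex.I_mul_I]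
  simp

end FreeQM

theorem proposition2p1 :
    (∀ f : FreeQM.L2mu,
      (∀ᵐ x ∂FreeQM.semicircleLaw, ∃ L : ℂ, FreeQM.HasMuHilbertAt f x L) ∧
      MemLp (FreeQM.muHilbert f) 2 FreeQM.semicircleLaw ∧
      (∀ᵐ x ∂FreeQM.semicircleLaw,
        FreeQM.momentum f x = Complex.I * FreeQM.muHilbert f x)) ∧
    (∀ f : FreeQM.L2mu,
      (∀ᵐ x ∂FreeQM.semicircleLaw,
        ∃ L : ℂ, FreeQM.HasMuHilbertAt (FreeQM.muHilbert f) x L) ∧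
      (∀ᵐ x ∂FreeQM.semicircleLaw,
        FreeQM.kineticEnergy f x =
          -(1 / 2) * FreeQM.muHilbert (FreeQM.muHilbert f) x)) := by
  have hiter : ∀ f : FreeQM.L2mu, ∀ᵐ x ∂FreeQM.semicircleLaw, FreeQM.HasMuHilbertAt
      (FreeQM.muHilbert f) x (FreeQM.ladderDiff (FreeQM.ladderDiff f) x) := fun f => by
    filter_upwards [FreeQM.ae_hasMuHilbertAt (FreeQM.ladderDiff f)] with x hx
    exact hx.congr_ae (FreeQM.muHilbert_ae_eq f).symm
  refine ⟨fun f => ⟨?_, ?_, ?_⟩, fun f => ⟨?_, ?_⟩⟩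
  · filter_upwards [FreeQM.ae_hasMuHilbertAt f] with x hx using ⟨_, hx⟩
  · exact (memLp_congr_ae (FreeQM.muHilbert_ae_eq f)).2 (Lp.memLp _)
  · rw [FreeQM.momentum_apply]
    filter_upwards [FreeQM.muHilbert_ae_eq f, Lp.coeFn_smul Complex.I (FreeQM.ladderDiff f)]
      with x h1 h2
    rw [h2, h1, Pi.smul_apply, smul_eq_mul]
  · filter_upwards [hiter f] with x hx using ⟨_, hx⟩
  · rw [FreeQM.kineticEnergy_apply]
    filter_upwards [hiter f, Lp.coeFn_smul (-(1 / 2) : ℂ)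
      (FreeQM.ladderDiff (FreeQM.ladderDiff f))] with x h1 h2
    rw [h2, h1.muHilbert_eq, Pi.smul_apply, smul_eq_mul]
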